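/- For $n\ge 1$ let $X_n=\{1,\dots,n\}\times\mathbb{N}$, and let permutations of $X_n$ act from the right. Let $\mathrm{FSym}(X_n)$ be the group of permutations of $X_n$ that move only finitely many points. Let $H_n\le \mathrm{Sym}(X_n)$ be the Houghton group, i.e. the group of all permutations $g$ of $X_n$ for which there are $z_1,\dots,z_n\in\mathbb{N}$ and $t_1,\dots,t_n\in\mathbb{Z}$ with $(i,m)g=(i,m+t_i)$ for all $i$ and all $m\ge z_i$. Let $S_n$ act on $X_n$ by $(i,m)\sigma=(i\sigma,m)$, and regard $H_n\rtimes S_n$ as the subgroup of $\mathrm{Sym}(X_n)$ generated by $H_n$ and $S_n$. Fix $n$ and a finite family $s_1,\dots,s_k$ of elements of $H_n\rtimes S_n$ (for instance, when $n\ge 2$, a finite generating set of this group). There is an algorithm which, given two words over $s_1^{\pm1},\dots,s_k^{\pm1}$ representing elements $a,b\in H_n\rtimes S_n$, decides whether there exists $x\in\mathrm{FSym}(X_n)$ with $x^{-1}ax=b$ and, if such an $x$ exists, outputs one (as a finite product of transpositions of points of $X_n$). -/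

import Mathlib

namespace Houghton

open Equiv

/-- The set `X_n`: `n` copies (rays) of the natural numbers. A point `(i, m)` is the point at
position `m` of the `i`-th ray, positions being counted from `0`. -/
abbrev X (n : ℕ) : Type := Fin n × ℕ

/-- The finitary symmetric group: the permutations which move only finitely many points. -/
def FSym (α : Type*) : Subgroup (Perm α) where
  carrier := {g | {p | g p ≠ p}.Finite}
  one_mem' := by simp
  mul_mem' := by
    intro a b ha hb
    refine (Set.Finite.union ha hb).subset ?_
    intro p hp
    by_contra hc
    simp only [Set.mem_union, Set.mem_ofPred_eq, not_or, not_not] at hc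
    exact hp (by rw [Perm.mul_apply, hc.2, hc.1])
  inv_mem' := by
    intro a ha
    refine Set.Finite.subset ha ?_
    intro p hp hc
    exact hp (by rw [Perm.inv_eq_iff_eq, hc])

/-- `g` maps `(i, m)` to `(i, m + t i)` for all `m ≥ z i`, on every ray `i`. -/
def EventuallyTranslates {n : ℕ} (g : Perm (X n)) (z : Fin n → ℕ) (t : Fin n → ℤ) : Prop :=
  ∀ i m, z i ≤ m → (g (i, m)).1 = i ∧ ((g (i, m)).2 : ℤ) = m + t i

/-- The Houghton group `H_n`: the permutations of `X_n` that are eventually a translation on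
each ray. -/
def H (n : ℕ) : Subgroup (Perm (X n)) where
  carrier := {g | ∃ z t, EventuallyTranslates g z t}
  one_mem' := ⟨0, 0, fun i m _ => by simp⟩
  mul_mem' := by
    rintro a b ⟨z, t, h⟩ ⟨z', t', h'⟩
    refine ⟨fun i => z' i + z i + (t' i).natAbs, fun i => t i + t' i, fun i m hm => ?_⟩
    dsimp only at hm
    obtain ⟨h1, h2⟩ := h' i m (by omega)
    have hb : b (i, m) = (i, (b (i, m)).2) := Prod.ext h1 rfl
    obtain ⟨h3, h4⟩ := h i (b (i, m)).2 (by omega)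
    rw [← hb] at h3 h4
    exact ⟨h3, by rw [Perm.mul_apply, h4, h2]; ring⟩
  inv_mem' := by
    rintro a ⟨z, t, h⟩
    refine ⟨fun i => z i + (t i).natAbs, fun i => - t i, fun i m hm => ?_⟩
    dsimp only at hm
    obtain ⟨k, hk⟩ : ∃ k : ℕ, (k : ℤ) = m - t i := ⟨(m - t i).toNat, by omega⟩
    obtain ⟨h1, h2⟩ := h i k (by omega)
    have ha : a (i, k) = (i, m) := Prod.ext h1 (by omega)
    have hi : a⁻¹ (i, m) = (i, k) := by rw [Perm.inv_eq_iff_eq, ha]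
    rw [hi]
    exact ⟨rfl, by rw [hk]; ring⟩

/-- The action of `S_n` on `X_n` by isometric permutations of the rays, `(i, m) ↦ (σ i, m)`. -/
def rayPerm (n : ℕ) : Perm (Fin n) →* Perm (X n) where
  toFun σ := σ.prodCongr (Equiv.refl ℕ)
  map_one' := by ext p <;> simp
  map_mul' σ τ := by ext p <;> simp

/-- The group `H_n ⋊ S_n`, as the subgroup of `Sym(X_n)` generated by `H_n` and the isometric
permutations of the rays. (The latter normalise `H_n` and meet it trivially, so that this is the
internal semidirect product.) -/
def HS (n : ℕ) : Subgroup (Perm (X n)) := H n ⊔ (rayPerm n).range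

/-- Words over the alphabet of `k` generators and their formal inverses: `(j, true)` stands for
the `j`-th generator and `(j, false)` for its inverse. -/
abbrev Word (k : ℕ) : Type := List (Fin k × Bool)

/-- The permutation that a letter represents. -/
def letterPerm {α : Type*} {k : ℕ} (s : Fin k → Perm α) (c : Fin k × Bool) : Perm α :=
  if c.2 then s c.1 else (s c.1)⁻¹

/-- The permutation that a word represents. Permutations act from the right in words: the first
letter is applied first. -/
def wordPerm {α : Type*} {k : ℕ} (s : Fin k → Perm α) : Word k → Perm α
  | [] => 1
  | c :: w => wordPerm s w * letterPerm s c

/-- `x` conjugates `a` to `b`. For permutations acting from the right this is `x⁻¹ a x = b`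
(first `x⁻¹`, then `a`, then `x`); as functions composed from right to left it reads as below. -/
def Conjugates {α : Type*} (x a b : Perm α) : Prop := x * a * x⁻¹ = b

/-- The finitary permutation described by a finite list of pairs of points: the product of the
corresponding transpositions. -/
def swapsPerm {α : Type*} [DecidableEq α] (l : List (α × α)) : Perm α :=
  (l.map fun p => swap p.1 p.2).prod

end Houghton

/-!
Suppose that a finitary permutation `x` conjugates `a` into `b`. Far out on the rays `x` is the
identity, so `a` and `b` permute and translate the rays in the same way and agree at all points
beyond a bound that is linear in the lengths of the words.

The orbits that `a` keeps beyond this bound are orbits of `b` as well. Replacing `x` by the identity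
on them, and by the first-return map of `x` on the complement, gives another conjugator. It also
fixes every far point `p`: according to the sign of the total translation along a period of the
permutation of the rays, the forward or the backward half of the orbit of `p` stays beyond the
bound. If `x` moves every point of this half orbit, then the half orbit lies in the finite support
of `x`, hence is the whole orbit. Otherwise `x` fixes some point of it, and therefore `p`, since `a`
and `b` agree along it.

So a conjugator can be sought among the finitely many permutations supported in a computable finite
region, and the conjugacy equation needs to be tested only in a slightly larger one.
-/

namespace Houghton

open Equiv Function Filter

section Dynamics

variable {α : Type*} {x a b : Perm α} {S R : Set α} {p q q' : α}

theorem mem_periodicPts_of_finite (hS : S.Finite) (h : ∀ k : ℕ, (a ^ k) p ∈ S) :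
    p ∈ periodicPts a := by
  obtain ⟨i, j, hij, he⟩ := hS.exists_lt_map_eq_of_forall_mem h
  refine mk_mem_periodicPts (Nat.sub_pos_of_lt hij) (iterate_cancel a.injective ?_)
  rw [Perm.iterate_eq_pow, Perm.iterate_eq_pow, he]

theorem mem_periodicPts_inv (hp : p ∈ periodicPts a) : p ∈ periodicPts ⇑a⁻¹ := by
  obtain ⟨k, hk, h⟩ := hp
  refine mk_mem_periodicPts hk ?_
  rw [IsPeriodicPt, IsFixedPt, Perm.iterate_eq_pow] at h ⊢
  rw [inv_pow, Perm.inv_eq_iff_eq, h]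

theorem mem_periodicPts_of_mem_FSym (hx : x ∈ FSym α) (p : α) : p ∈ periodicPts x := by
  by_cases hp : x p = p
  · exact mk_mem_periodicPts one_pos hp
  · exact mem_periodicPts_of_finite hx fun k => (Perm.apply_pow_apply_eq_iff x k).not.2 hp

theorem zpow_apply_mem_of_mem_periodicPts (hp : p ∈ periodicPts a)
    (h : ∀ k : ℕ, (a ^ k) p ∈ R) (k : ℤ) : (a ^ k) p ∈ R := by
  have hpos : 0 < minimalPeriod (a • ·) p := minimalPeriod_pos_of_mem_periodicPts hp
  have hk := MulAction.zpow_smul_mod_minimalPeriod a p k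
  rw [Perm.smul_def, Perm.smul_def] at hk
  obtain ⟨l, hl⟩ := Int.eq_ofNat_of_zero_le (Int.emod_nonneg k (Nat.cast_ne_zero.2 hpos.ne'))
  rw [← hk, hl, zpow_natCast]
  exact h l

/-- `q` is the first of the points `x p`, `x² p`, … that lies in `S`. -/
structure FirstReturn (x : Perm α) (S : Set α) (p q : α) : Prop where
  mem : q ∈ S
  exists_pow_eq : ∃ j : ℕ, (x ^ (j + 1)) p = q ∧ ∀ i < j, (x ^ (i + 1)) p ∉ S

theorem FirstReturn.unique (h : FirstReturn x S p q) (h' : FirstReturn x S p q') : q = q' := by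
  obtain ⟨hq, j, rfl, hj⟩ := h
  obtain ⟨hq', j', rfl, hj'⟩ := h'
  rcases lt_trichotomy j j' with hlt | rfl | hlt
  · exact absurd hq (hj' j hlt)
  · rfl
  · exact absurd hq' (hj j' hlt)

theorem FirstReturn.inv (hp : p ∈ S) (h : FirstReturn x S p q) : FirstReturn x⁻¹ S q p := by
  obtain ⟨-, j, rfl, hj⟩ := h
  refine ⟨hp, j, by simp, fun i hi => ?_⟩
  obtain ⟨l, rfl⟩ := Nat.exists_eq_add_of_lt hi
  have hpow : x ^ (i + l + 1 + 1) = x ^ (i + 1) * x ^ (l + 1) := by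
    rw [← pow_add]
    congr 1
    omega
  rw [hpow, Perm.mul_apply, inv_pow, Perm.inv_def, symm_apply_apply]
  exact hj l (by omega)

theorem exists_firstReturn (hx : p ∈ periodicPts x) (hp : p ∈ S) : ∃ q, FirstReturn x S p q := by
  classical
  have hret : ∃ j : ℕ, (x ^ (j + 1)) p ∈ S := by
    obtain ⟨j, hj, h⟩ := hx
    refine ⟨j - 1, ?_⟩
    rwa [Nat.sub_add_cancel hj, ← Perm.iterate_eq_pow, h.eq]
  exact ⟨_, Nat.find_spec hret, Nat.find hret, rfl, fun _ => Nat.find_min hret⟩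

theorem exists_perm_firstReturn (hx : ∀ p ∈ S, p ∈ periodicPts x) :
    ∃ y : Perm S, ∀ p : S, FirstReturn x S p (y p) := by
  choose r hr using fun p : S => exists_firstReturn (hx p p.2) p.2
  choose r' hr' using fun p : S => exists_firstReturn (mem_periodicPts_inv (hx p p.2)) p.2
  let ret : S → S := fun p => ⟨r p, (hr p).mem⟩
  let ret' : S → S := fun p => ⟨r' p, (hr' p).mem⟩
  have hleft (p : S) : ret' (ret p) = p :=
    Subtype.ext ((hr' (ret p)).unique ((hr p).inv p.2))
  have hright (p : S) : ret (ret' p) = p :=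
    Subtype.ext ((hr (ret' p)).unique (inv_inv x ▸ (hr' p).inv p.2))
  exact ⟨⟨ret, ret', hleft, hright⟩, hr⟩

theorem semiconjBy_iff_forall_apply : SemiconjBy x a b ↔ ∀ p, x (a p) = b (x p) :=
  Equiv.ext_iff

theorem FirstReturn.apply_apply (h : SemiconjBy x a b) (hab : Set.EqOn a b Sᶜ)
    (hb : ∀ p, b p ∈ S ↔ p ∈ S) (hr : FirstReturn x S p q) :
    FirstReturn x S (a p) (b q) := by
  rw [semiconjBy_iff_forall_apply] at h
  obtain ⟨hq, j, rfl, hj⟩ := hr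
  have hpow (i : ℕ) (hi : i ≤ j) : (x ^ (i + 1)) (a p) = b ((x ^ (i + 1)) p) := by
    induction i with
    | zero => simpa using h p
    | succ i ih =>
      rw [pow_succ', Perm.mul_apply, ih (by omega), ← hab (hj i hi), h, Perm.mul_apply]
  refine ⟨(hb _).2 hq, j, hpow j le_rfl, fun i hi => ?_⟩
  rw [hpow i hi.le, hb]
  exact hj i hi

theorem apply_mem_iff_of_eqOn (hab : Set.EqOn a b R) (ha : ∀ p, a p ∈ R ↔ p ∈ R) (p : α) :
    b p ∈ R ↔ p ∈ R := by
  refine ⟨fun hp => ?_, fun hp => hab hp ▸ (ha p).2 hp⟩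
  obtain ⟨q, hq⟩ := a.surjective (b p)
  have hqR : q ∈ R := (ha q).1 (hq ▸ hp)
  exact b.injective ((hab hqR).symm.trans hq) ▸ hqR

/-- Outside `S` the new conjugator is the identity; on `S` it is the first-return map of `x`. -/
theorem exists_semiconjBy_fixing_compl (hx : ∀ p ∈ S, p ∈ periodicPts x) (h : SemiconjBy x a b)
    (hab : Set.EqOn a b Sᶜ) (ha : ∀ p, a p ∈ S ↔ p ∈ S) :
    ∃ y : Perm α, SemiconjBy y a b ∧ (∀ p ∉ S, y p = p) ∧ ∀ p, x p = p → y p = p := by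
  classical
  have hb (p : α) : b p ∈ S ↔ p ∈ S :=
    not_iff_not.1 (apply_mem_iff_of_eqOn hab (fun p => (ha p).not) p)
  obtain ⟨r, hr⟩ := exists_perm_firstReturn hx
  have hy (p : α) (hp : p ∉ S) : Perm.ofSubtype r p = p := Perm.ofSubtype_apply_of_not_mem r hp
  have hy' (p : α) (hp : p ∈ S) : FirstReturn x S p (Perm.ofSubtype r p) := by
    rw [Perm.ofSubtype_apply_of_mem r hp]
    exact hr ⟨p, hp⟩
  refine ⟨Perm.ofSubtype r, semiconjBy_iff_forall_apply.2 fun p => ?_, hy, fun p hp => ?_⟩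
  · by_cases hpS : p ∈ S
    · exact (hy' _ ((ha p).2 hpS)).unique ((hy' p hpS).apply_apply h hab hb)
    · rw [hy p hpS, hy _ ((ha p).not.2 hpS), hab hpS]
  · by_cases hpS : p ∈ S
    · obtain ⟨-, j, hj, -⟩ := hy' p hpS
      rw [← hj, Perm.pow_apply_eq_self_of_apply_eq_self hp]
    · exact hy p hpS

theorem apply_pow_eq_pow_apply_of_eqOn (hab : Set.EqOn a b R) (hp : ∀ k : ℕ, (a ^ k) p ∈ R)
    (k : ℕ) : (a ^ k) p = (b ^ k) p := by
  induction k with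
  | zero => rfl
  | succ k ih => rw [pow_succ', Perm.mul_apply, hab (hp k), ih, pow_succ', Perm.mul_apply]

theorem zpow_mem_or_apply_eq_self (hx : x ∈ FSym α) (h : SemiconjBy x a b)
    (hab : Set.EqOn a b R) (hp : ∀ k : ℕ, (a ^ k) p ∈ R) :
    (∀ k : ℤ, (a ^ k) p ∈ R) ∨ x p = p := by
  by_cases hfix : ∃ k : ℕ, x ((a ^ k) p) = (a ^ k) p
  · obtain ⟨k, hk⟩ := hfix
    rw [semiconjBy_iff_forall_apply.1 (h.pow_right k), apply_pow_eq_pow_apply_of_eqOn hab hp] at hk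
    exact .inr ((b ^ k).injective hk)
  · push Not at hfix
    exact .inl (zpow_apply_mem_of_mem_periodicPts (mem_periodicPts_of_finite hx hfix) hp)

theorem exists_semiconjBy_fixing_half_orbits (hx : x ∈ FSym α) (h : SemiconjBy x a b)
    (hab : Set.EqOn a b R) (hab' : Set.EqOn ⇑a⁻¹ ⇑b⁻¹ R) :
    ∃ y : Perm α, SemiconjBy y a b ∧
      ∀ p, (∀ k : ℕ, (a ^ k) p ∈ R) ∨ (∀ k : ℕ, (a⁻¹ ^ k) p ∈ R) → y p = p := by
  let G : Set α := {p | ∀ k : ℤ, (a ^ k) p ∈ R}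
  have hG (p : α) : a p ∈ G ↔ p ∈ G := by
    refine (Equiv.addRight (1 : ℤ)).forall_congr fun k => ?_
    rw [Equiv.coe_addRight, zpow_add_one, Perm.mul_apply]
  obtain ⟨y, hy, hyG, hyx⟩ := exists_semiconjBy_fixing_compl (S := Gᶜ)
    (fun p _ => mem_periodicPts_of_mem_FSym hx p) h
    (fun p hp => hab (Set.notMem_compl_iff.1 hp 0)) fun p => (hG p).not
  have hfix (p : α) : p ∈ G ∨ x p = p → y p = p :=
    Or.rec (fun hp => hyG p (Set.notMem_compl_iff.2 hp)) (hyx p)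
  refine ⟨y, hy, fun p hp => hfix p ?_⟩
  rcases hp with hp | hp
  · exact zpow_mem_or_apply_eq_self hx h hab hp
  · refine (zpow_mem_or_apply_eq_self hx h.inv_right hab' hp).imp_left fun hpR k => ?_
    simpa using hpR (-k)

theorem eventuallyEq_cofinite_of_semiconjBy (hx : x ∈ FSym α) (h : SemiconjBy x a b) :
    a =ᶠ[cofinite] b := by
  have hfix : ∀ᶠ p in cofinite, x p = p := hx
  filter_upwards [hfix, a.injective.tendsto_cofinite.eventually hfix] with p hp hap
  rw [← hap, semiconjBy_iff_forall_apply.1 h, hp]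

end Dynamics

section BirkhoffSum

variable {α M : Type*} [AddCommGroup M]

theorem birkhoffSum_inv_neg (σ : Perm α) (t : α → M) (k : ℕ) (i : α) :
    birkhoffSum ⇑σ⁻¹ (fun j => -t (σ⁻¹ j)) k i = -birkhoffSum σ t k ((σ⁻¹ ^ k) i) := by
  induction k with
  | zero => simp
  | succ k ih =>
    have hσ : σ ((σ⁻¹ ^ (k + 1)) i) = (σ⁻¹ ^ k) i := by
      rw [pow_succ', ← Perm.mul_apply, mul_inv_cancel_left]
    rw [birkhoffSum_succ, ih, birkhoffSum_succ', hσ, Perm.iterate_eq_pow, pow_succ', Perm.mul_apply,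
      neg_add_rev]

theorem neg_nsmul_le_birkhoffSum [PartialOrder M] [IsOrderedAddMonoid M] {f : α → α} {t : α → M}
    {c : M} {d : ℕ} {i : α} (hc : 0 ≤ c) (ht : ∀ j, -c ≤ t j) (hd : 0 < d)
    (hi : IsPeriodicPt f d i) (hsum : 0 ≤ birkhoffSum f t d i) (k : ℕ) :
    -(d • c) ≤ birkhoffSum f t k i := by
  induction k using Nat.strong_induction_on with
  | _ k ih =>
    rcases lt_or_ge k d with hk | hk
    · calc -(d • c) ≤ -(k • c) := neg_le_neg (nsmul_le_nsmul_left hc hk.le)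
        _ = (Finset.range k).card • -c := by rw [Finset.card_range, smul_neg]
        _ ≤ birkhoffSum f t k i := Finset.card_nsmul_le_sum _ _ _ fun j _ => ht _
    · obtain ⟨l, rfl⟩ := Nat.exists_eq_add_of_le hk
      rw [birkhoffSum_add, hi.eq]
      exact le_add_of_nonneg_of_le hsum (ih l (by omega))

end BirkhoffSum

/-- `g` maps `(i, m)` to `(σ i, m + t i)` for all `m ≥ N`. The same number `N` bounds the lengths
of the translations, so that no truncation takes place in `(m + t i).toNat` for these `m`. -/
structure EventuallyPermutesRays {ι : Type*} (g : Perm (ι × ℕ)) (σ : Perm ι) (t : ι → ℤ)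
    (N : ℕ) : Prop where
  natAbs_le : ∀ i, (t i).natAbs ≤ N
  apply_eq : ∀ i m, N ≤ m → g (i, m) = (σ i, (m + t i).toNat)

namespace EventuallyPermutesRays

variable {ι : Type*} {a b g h x : Perm (ι × ℕ)} {σ τ : Perm ι} {t u : ι → ℤ} {L M N : ℕ}

theorem mono (hg : EventuallyPermutesRays g σ t N) (hNM : N ≤ M) :
    EventuallyPermutesRays g σ t M :=
  ⟨fun i => (hg.natAbs_le i).trans hNM, fun i m hm => hg.apply_eq i m (hNM.trans hm)⟩

protected theorem one : EventuallyPermutesRays (1 : Perm (ι × ℕ)) 1 0 0 :=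
  ⟨by simp, by simp⟩

protected theorem mul (hg : EventuallyPermutesRays g σ t N) (hh : EventuallyPermutesRays h τ u M) :
    EventuallyPermutesRays (g * h) (σ * τ) (fun i => u i + t (τ i)) (N + M) where
  natAbs_le i := by
    have ht := hg.natAbs_le (τ i)
    have hu := hh.natAbs_le i
    omega
  apply_eq i m hm := by
    have hu := hh.natAbs_le i
    rw [Perm.mul_apply, hh.apply_eq i m (by omega), hg.apply_eq _ _ (by omega), Perm.mul_apply]
    congr 1
    omega

protected theorem inv (hg : EventuallyPermutesRays g σ t N) :
    EventuallyPermutesRays g⁻¹ σ⁻¹ (fun i => -t (σ⁻¹ i)) (2 * N) where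
  natAbs_le i := by
    have ht := hg.natAbs_le (σ⁻¹ i)
    omega
  apply_eq i m hm := by
    have ht := hg.natAbs_le (σ⁻¹ i)
    rw [Perm.inv_eq_iff_eq, hg.apply_eq _ _ (by omega), ← Perm.mul_apply σ, mul_inv_cancel,
      Perm.one_apply]
    congr 1
    omega

theorem eq_of_apply_eq (hg : EventuallyPermutesRays g σ t N) (hh : EventuallyPermutesRays h τ u N)
    {i : ι} {m : ℕ} (hm : N ≤ m) (he : g (i, m) = h (i, m)) : σ i = τ i ∧ t i = u i := by
  have ht := hg.natAbs_le i
  have hu := hh.natAbs_le i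
  rw [hg.apply_eq i m hm, hh.apply_eq i m hm, Prod.mk_inj] at he
  exact ⟨he.1, by omega⟩

theorem eq_of_eventuallyEq (hg : EventuallyPermutesRays g σ t N)
    (hh : EventuallyPermutesRays h τ u N) (he : g =ᶠ[cofinite] h) : σ = τ ∧ t = u := by
  have hray (i : ι) : σ i = τ i ∧ t i = u i := by
    have hev : ∀ᶠ m : ℕ in atTop, g (i, m) = h (i, m) := by
      rw [← Nat.cofinite_eq_atTop]
      exact (Prod.mk_right_injective i).tendsto_cofinite.eventually he
    obtain ⟨m, he, hm⟩ := (hev.and (eventually_ge_atTop N)).exists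
    exact hg.eq_of_apply_eq hh hm he
  exact ⟨Equiv.ext fun i => (hray i).1, funext fun i => (hray i).2⟩

theorem eqOn (hg : EventuallyPermutesRays g σ t N) (hh : EventuallyPermutesRays h σ t N) :
    Set.EqOn g h {p | N ≤ p.2} :=
  fun p hp => (hg.apply_eq p.1 p.2 hp).trans (hh.apply_eq p.1 p.2 hp).symm

theorem pow_apply (hg : EventuallyPermutesRays g σ t N) {i : ι} {m : ℕ}
    (hm : ∀ k, (N : ℤ) ≤ m + birkhoffSum σ t k i) (k : ℕ) :
    (g ^ k) (i, m) = ((σ ^ k) i, (m + birkhoffSum σ t k i).toNat) := by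
  induction k with
  | zero => simp
  | succ k ih =>
    have hk := hm k
    rw [pow_succ', Perm.mul_apply, ih, hg.apply_eq _ _ (by omega), birkhoffSum_succ, pow_succ',
      Perm.mul_apply, Perm.iterate_eq_pow]
    congr 1
    omega

theorem le_snd_pow_apply (hg : EventuallyPermutesRays g σ t N) {d : ℕ} (hd : 0 < d)
    (hσ : σ ^ d = 1) {i : ι} (hi : 0 ≤ birkhoffSum σ t d i) {m : ℕ} (hm : N * (d + 1) ≤ m)
    (k : ℕ) : N ≤ ((g ^ k) (i, m)).2 := by
  have hperiod : IsPeriodicPt σ d i := by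
    rw [IsPeriodicPt, IsFixedPt, Perm.iterate_eq_pow, hσ, Perm.one_apply]
  have hfar (k : ℕ) : (N : ℤ) ≤ m + birkhoffSum σ t k i := by
    have hsum := neg_nsmul_le_birkhoffSum (c := (N : ℤ)) (by omega)
      (fun j => by have := hg.natAbs_le j; omega) hd hperiod hi k
    rw [nsmul_eq_mul] at hsum
    zify at hm
    linarith
  rw [hg.pow_apply hfar k]
  have := hfar k
  omega

theorem far_half_orbit (hg : EventuallyPermutesRays g σ t N) {d : ℕ} (hd : 0 < d) (hσ : σ ^ d = 1)
    {p : ι × ℕ} (hp : 2 * N * (d + 1) ≤ p.2) :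
    (∀ k, 2 * N ≤ ((g ^ k) p).2) ∨ (∀ k, 2 * N ≤ ((g⁻¹ ^ k) p).2) := by
  have hσ' : σ⁻¹ ^ d = 1 := by rw [inv_pow, hσ, inv_one]
  refine (le_total 0 (birkhoffSum σ t d p.1)).imp (fun hi => ?_) fun hi => ?_
  · exact (hg.mono (by omega)).le_snd_pow_apply hd hσ hi hp
  · refine hg.inv.le_snd_pow_apply hd hσ' ?_ hp
    rwa [birkhoffSum_inv_neg, hσ', Perm.one_apply, neg_nonneg]

theorem exists_semiconjBy_fixing_far (ha : EventuallyPermutesRays a σ t N)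
    (hb : EventuallyPermutesRays b τ u N) {d : ℕ} (hd : 0 < d) (hσ : σ ^ d = 1)
    (hx : x ∈ FSym (ι × ℕ)) (hxab : SemiconjBy x a b) :
    ∃ y, SemiconjBy y a b ∧ ∀ p, 2 * N * (d + 1) ≤ p.2 → y p = p := by
  obtain ⟨rfl, rfl⟩ := ha.eq_of_eventuallyEq hb (eventuallyEq_cofinite_of_semiconjBy hx hxab)
  obtain ⟨y, hy, hfix⟩ := exists_semiconjBy_fixing_half_orbits hx hxab
    ((ha.mono (by omega)).eqOn (hb.mono (by omega))) (ha.inv.eqOn hb.inv)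
  exact ⟨y, hy, fun p hp => hfix p (ha.far_half_orbit hd hσ hp)⟩

theorem semiconjBy_of_forall_lt (ha : EventuallyPermutesRays a σ t N)
    (hb : EventuallyPermutesRays b τ u N) (hNM : N ≤ M) (hL : M + N < L)
    (hx : ∀ p, M ≤ p.2 → x p = p) (hxab : ∀ p, p.2 < L → x (a p) = b (x p)) :
    SemiconjBy x a b := by
  have hfix (i : ι) (m : ℕ) (hm : M + N ≤ m) :
      x (i, m) = (i, m) ∧ x (a (i, m)) = a (i, m) := by
    have ht := ha.natAbs_le i
    refine ⟨hx _ (by dsimp only; omega), hx _ ?_⟩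
    rw [ha.apply_eq i m (by omega)]
    omega
  refine semiconjBy_iff_forall_apply.2 fun ⟨i, m⟩ => ?_
  rcases le_or_gt m (M + N) with hm | hm
  · exact hxab _ (hm.trans_lt hL)
  · have he := hxab (i, M + N) hL
    rw [(hfix i _ le_rfl).1, (hfix i _ le_rfl).2] at he
    obtain ⟨hσ, ht⟩ := ha.eq_of_apply_eq hb (by omega) he
    rw [(hfix i m hm.le).1, (hfix i m hm.le).2, ha.apply_eq i m (by omega),
      hb.apply_eq i m (by omega), hσ, ht]

end EventuallyPermutesRays

section HoughtonGroup

/-- The permutations that eventually act on the rays by permuting and translating them. For finite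
`ι` this is the group generated by the Houghton group and the permutations of the rays, in an
intrinsic description. -/
def extendedHoughtonGroup (ι : Type*) : Subgroup (Perm (ι × ℕ)) where
  carrier := {g | ∃ σ t N, EventuallyPermutesRays g σ t N}
  one_mem' := ⟨1, 0, 0, .one⟩
  mul_mem' := fun ⟨_, _, _, hg⟩ ⟨_, _, _, hh⟩ => ⟨_, _, _, hg.mul hh⟩
  inv_mem' := fun ⟨_, _, _, hg⟩ => ⟨_, _, _, hg.inv⟩

variable {ι : Type*} {n k : ℕ}

theorem EventuallyTranslates.eventuallyPermutesRays {g : Perm (X n)} {z : Fin n → ℕ}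
    {t : Fin n → ℤ} (h : EventuallyTranslates g z t) :
    EventuallyPermutesRays g 1 t (Finset.univ.sup fun i => z i + (t i).natAbs) := by
  have hle (i : Fin n) : z i + (t i).natAbs ≤ Finset.univ.sup fun i => z i + (t i).natAbs :=
    Finset.le_sup (f := fun i => z i + (t i).natAbs) (Finset.mem_univ i)
  refine ⟨fun i => (Nat.le_add_left _ _).trans (hle i), fun i m hm => ?_⟩
  obtain ⟨h₁, h₂⟩ := h i m ((Nat.le_add_right _ _).trans ((hle i).trans hm))
  exact Prod.ext h₁ (by rw [← h₂, Int.toNat_natCast])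

theorem HS_le_extendedHoughtonGroup : HS n ≤ extendedHoughtonGroup (Fin n) := by
  refine sup_le (fun g ⟨_, _, h⟩ => ⟨_, _, _, h.eventuallyPermutesRays⟩) ?_
  rintro _ ⟨σ, rfl⟩
  exact ⟨σ, 0, 0, by simp, by simp [rayPerm]⟩

theorem letterPerm_mem {α : Type*} {s : Fin k → Perm α} {K : Subgroup (Perm α)}
    (hs : ∀ j, s j ∈ K) (c : Fin k × Bool) : letterPerm s c ∈ K := by
  unfold letterPerm
  split_ifs
  exacts [hs _, inv_mem (hs _)]

variable {s : Fin k → Perm (ι × ℕ)}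

theorem exists_forall_letterPerm_eventuallyPermutesRays
    (hs : ∀ j, s j ∈ extendedHoughtonGroup ι) :
    ∃ C, ∀ c, ∃ σ t, EventuallyPermutesRays (letterPerm s c) σ t C := by
  choose σ t N h using letterPerm_mem hs
  exact ⟨Finset.univ.sup N, fun c => ⟨σ c, t c, (h c).mono (Finset.le_sup (Finset.mem_univ c))⟩⟩

theorem exists_wordPerm_eventuallyPermutesRays {C : ℕ}
    (hC : ∀ c, ∃ σ t, EventuallyPermutesRays (letterPerm s c) σ t C) (w : Word k) :
    ∃ σ t, EventuallyPermutesRays (wordPerm s w) σ t (C * w.length) := by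
  induction w with
  | nil => exact ⟨_, _, .one⟩
  | cons c w ih =>
    obtain ⟨_, _, hw⟩ := ih
    obtain ⟨_, _, hc⟩ := hC c
    exact ⟨_, _, hw.mul hc⟩

end HoughtonGroup

section Swaps

variable {α : Type*}

/-- Lists of transpositions of points of `P` whose products are all the permutations of the points
of `P`. A permutation `x` is peeled off point by point, the transposition belonging to `c` being
`swap c (x c)`. -/
def swapLists : List α → List (List (α × α))
  | [] => [[]]
  | c :: P => (c :: P).flatMap fun q => (swapLists P).map ((c, q) :: ·)

variable [DecidableEq α]

theorem swapsPerm_cons (q : α × α) (l : List (α × α)) :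
    swapsPerm (q :: l) = swap q.1 q.2 * swapsPerm l := by
  simp [swapsPerm]

theorem exists_mem_swapLists {P : List α} {x : Perm α} (hx : ∀ p ∉ P, x p = p) :
    ∃ l ∈ swapLists P, swapsPerm l = x := by
  induction P generalizing x with
  | nil => exact ⟨[], by simp [swapLists], Equiv.ext fun p => (hx p List.not_mem_nil).symm⟩
  | cons c P ih =>
    have hc : x c ∈ c :: P := by
      by_contra h
      exact h (by simp [x.injective (hx _ h)])
    have hfix (p : α) (hp : p ∉ P) : (swap c (x c) * x) p = p := by
      rcases eq_or_ne p c with rfl | hpc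
      · simp
      · have hxp : x p = p := hx p (by simp [hpc, hp])
        rw [Perm.mul_apply, hxp, swap_apply_of_ne_of_ne hpc]
        exact fun h => hpc (x.injective (hxp.trans h))
    obtain ⟨l, hl, hlx⟩ := ih hfix
    refine ⟨(c, x c) :: l, List.mem_flatMap.2 ⟨x c, hc, List.mem_map_of_mem hl⟩, ?_⟩
    rw [swapsPerm_cons, hlx, swap_mul_self_mul]

theorem swapsPerm_apply_of_notMem {P : List α} {l : List (α × α)} (hl : l ∈ swapLists P) {p : α}
    (hp : p ∉ P) : swapsPerm l p = p := by
  induction P generalizing l with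
  | nil =>
    obtain rfl : l = [] := List.mem_singleton.1 hl
    rfl
  | cons c P ih =>
    simp only [swapLists, List.mem_flatMap, List.mem_map] at hl
    obtain ⟨q, hq, l, hl, rfl⟩ := hl
    have hpq : p ≠ q := fun h => hp (h ▸ hq)
    rw [List.mem_cons, not_or] at hp
    rw [swapsPerm_cons, Perm.mul_apply, ih hl hp.2, swap_apply_of_ne_of_ne hp.1 hpq]

theorem swapsPerm_mem_FSym {P : List α} {l : List (α × α)} (hl : l ∈ swapLists P) :
    swapsPerm l ∈ FSym α :=
  P.finite_toSet.subset fun _ hp => not_imp_comm.1 (swapsPerm_apply_of_notMem hl) hp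

end Swaps

section PrimitiveRecursion

variable {α β γ : Type*} [Primcodable α] [Primcodable β] [Primcodable γ]

theorem primrec_of_eventuallyEq_cofinite {f g : α → β} (hg : Primrec g) (h : f =ᶠ[cofinite] g) :
    Primrec f := by
  have : DecidableEq α := Encodable.decidableEqOfEncodable α
  obtain ⟨S, hS⟩ : ∃ S : Finset α, ∀ a ∉ S, f a = g a :=
    ⟨Set.Finite.toFinset h, fun a ha => not_not.1 fun hne => ha ((Set.Finite.mem_toFinset h).2 hne)⟩
  let values (a : α) : Option β := (S.toList.map f)[S.toList.idxOf a]?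
  have hvalues : Primrec values := (Primrec.list_getElem?₁ _).comp (Primrec.list_idxOf₁ _)
  refine (Primrec.option_getD.comp hvalues hg).of_eq fun a => ?_
  by_cases ha : a ∈ S
  · simp [values, ha]
  · simp [values, ha, hS a ha]

theorem primrec₂_of_finite [Finite α] {f : α → β → γ} (hf : ∀ a, Primrec (f a)) : Primrec₂ f := by
  classical
  have hpartial (S : Set α) : ∃ g : α → β → Option γ, Primrec₂ g ∧ ∀ a ∈ S, ∀ b, g a b = f a b := by
    induction S, S.toFinite using Set.Finite.induction_on with
    | empty => exact ⟨fun _ _ => none, .const none, by simp⟩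
    | @insert a S _ _ ih =>
      obtain ⟨g, hg, hgf⟩ := ih
      refine ⟨fun a' b => if a' = a then some (f a b) else g a' b, ?_, ?_⟩
      · exact .ite (Primrec.eq.comp .fst (.const a))
          (Primrec.option_some.comp ((hf a).comp .snd)) hg
      · intro a' ha' b
        dsimp only
        split_ifs with h
        · rw [h]
        · exact hgf a' (ha'.resolve_left h) b
  obtain ⟨g, hg, hgf⟩ := hpartial Set.univ
  exact Primrec₂.option_some_iff.1 (hg.of_eq fun a b => hgf a (Set.mem_univ a) b)

theorem EventuallyPermutesRays.primrec {ι : Type*} [Finite ι] [Primcodable ι] {g : Perm (ι × ℕ)}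
    {σ : Perm ι} {t : ι → ℤ} {N : ℕ} (hg : EventuallyPermutesRays g σ t N) : Primrec g := by
  have hfar : Primrec fun p : ι × ℕ => (σ p.1, p.2 + (t p.1).toNat - (-t p.1).toNat) :=
    .pair ((Primrec.dom_finite σ).comp .fst) (Primrec.nat_sub.comp
      (Primrec.nat_add.comp .snd ((Primrec.dom_finite fun i => (t i).toNat).comp .fst))
      ((Primrec.dom_finite fun i => (-t i).toNat).comp .fst))
  refine primrec_of_eventuallyEq_cofinite hfar ?_
  refine (Set.finite_univ.prod (Set.finite_Iio N)).subset fun ⟨i, m⟩ hp => ⟨Set.mem_univ i, ?_⟩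
  by_contra hm
  refine hp ((hg.apply_eq i m (not_lt.1 hm)).trans (congrArg (Prod.mk _) ?_))
  dsimp only
  omega

theorem primrec_wordPerm {k : ℕ} {s : Fin k → Perm α} (hs : ∀ c, Primrec (letterPerm s c)) :
    Primrec₂ fun w => ⇑(wordPerm s w) := by
  refine (Primrec.list_foldl (h := fun _ r => letterPerm s r.2 r.1) .fst .snd
    ((primrec₂_of_finite hs).comp (Primrec.snd.comp .snd) (Primrec.fst.comp .snd)).to₂).of_eq ?_
  rintro ⟨w, p⟩
  induction w generalizing p with
  | nil => rfl
  | cons c _ ih => exact ih (letterPerm s c p)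

theorem primrec_swap_apply [DecidableEq α] :
    Primrec fun r : (α × α) × α => swap r.1.1 r.1.2 r.2 := by
  have hfst : Primrec fun r : (α × α) × α => r.1.1 := Primrec.fst.comp .fst
  have hsnd : Primrec fun r : (α × α) × α => r.1.2 := Primrec.snd.comp .fst
  exact (Primrec.ite (Primrec.eq.comp .snd hfst) hsnd
    (.ite (Primrec.eq.comp .snd hsnd) hfst .snd)).of_eq fun r => (swap_apply_def _ _ _).symm

theorem primrec_swapsPerm [DecidableEq α] :
    Primrec₂ fun l : List (α × α) => ⇑(swapsPerm l) := by
  refine (Primrec.list_foldr (h := fun _ r => swap r.1.1 r.1.2 r.2) .fst .snd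
    (primrec_swap_apply.comp .snd).to₂).of_eq ?_
  rintro ⟨l, p⟩
  induction l with
  | nil => rfl
  | cons q l ih =>
    simp only [List.foldr_cons] at ih ⊢
    rw [ih, swapsPerm_cons, Perm.mul_apply]

theorem primrec_swapLists : Primrec (swapLists : List α → List (List (α × α))) := by
  refine (Primrec.list_rec (f := id) (g := fun _ => [[]])
    (h := fun _ r => (r.1 :: r.2.1).flatMap fun q => r.2.2.map ((r.1, q) :: ·))
    .id (.const _) ?_).of_eq fun P => ?_
  · have hc : Primrec fun r : List α × α × List α × List (List (α × α)) => r.2.1 :=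
      Primrec.fst.comp .snd
    have hP : Primrec fun r : List α × α × List α × List (List (α × α)) => r.2.2.1 :=
      Primrec.fst.comp (Primrec.snd.comp .snd)
    have hl : Primrec fun r : List α × α × List α × List (List (α × α)) => r.2.2.2 :=
      Primrec.snd.comp (Primrec.snd.comp .snd)
    exact .list_flatMap (Primrec.list_cons.comp hc hP) (Primrec.list_map (hl.comp .fst)
      (Primrec.list_cons.comp (.pair (hc.comp (Primrec.fst.comp .fst)) (Primrec.snd.comp .fst))
        .snd).to₂).to₂
  · induction P with
    | nil => rfl
    | cons c P ih => exact congrArg (fun L => (c :: P).flatMap fun q => L.map ((c, q) :: ·)) ih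

end PrimitiveRecursion

section Search

/-- The points at positions below `N`, in some order. -/
noncomputable def pointsBelow (ι : Type*) [Fintype ι] (N : ℕ) : List (ι × ℕ) :=
  Finset.univ.toList ×ˢ List.range N

variable {ι : Type*} [Fintype ι]

theorem mem_pointsBelow {N : ℕ} {p : ι × ℕ} : p ∈ pointsBelow ι N ↔ p.2 < N := by
  obtain ⟨i, m⟩ := p
  simp [pointsBelow]

theorem primrec_pointsBelow [Primcodable ι] : Primrec (pointsBelow ι) :=
  .list_flatMap (.const _)
    (Primrec.list_map (Primrec.list_range.comp .fst)
      (Primrec.pair (Primrec.snd.comp .fst) .snd).to₂).to₂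

variable [DecidableEq ι] {k : ℕ} {s : Fin k → Perm (ι × ℕ)} {L M N : ℕ} {a b : Word k}

/-- A list of transpositions of points at positions below `M` whose product satisfies the equation
of a conjugator of `a` into `b` at all points at positions below `L`, found by exhaustive search. -/
noncomputable def findConjugator (s : Fin k → Perm (ι × ℕ)) (M L : ℕ) (a b : Word k) :
    Option (List ((ι × ℕ) × (ι × ℕ))) :=
  ((swapLists (pointsBelow ι M)).filter fun l => ∀ p ∈ pointsBelow ι L,
    swapsPerm l (wordPerm s a p) = wordPerm s b (swapsPerm l p)).head?

theorem primrec_findConjugator [Primcodable ι] (hs : ∀ c, Primrec (letterPerm s c))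
    {M L : Word k × Word k → ℕ} (hM : Primrec M) (hL : Primrec L) :
    Primrec fun w : Word k × Word k => findConjugator s (M w) (L w) w.1 w.2 := by
  have hcheck : PrimrecRel fun (p : ι × ℕ) (r : List ((ι × ℕ) × (ι × ℕ)) × Word k × Word k) =>
      swapsPerm r.1 (wordPerm s r.2.1 p) = wordPerm s r.2.2 (swapsPerm r.1 p) := by
    have hl := Primrec.fst.comp (Primrec.snd (α := ι × ℕ)
      (β := List ((ι × ℕ) × (ι × ℕ)) × Word k × Word k))
    have hw := Primrec.snd.comp (Primrec.snd (α := ι × ℕ)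
      (β := List ((ι × ℕ) × (ι × ℕ)) × Word k × Word k))
    exact Primrec.eq.comp
      (primrec_swapsPerm.comp hl ((primrec_wordPerm hs).comp (Primrec.fst.comp hw) .fst))
      ((primrec_wordPerm hs).comp (Primrec.snd.comp hw) (primrec_swapsPerm.comp hl .fst))
  have hall : PrimrecRel fun (l : List ((ι × ℕ) × (ι × ℕ))) (w : Word k × Word k) =>
      ∀ p ∈ pointsBelow ι (L w),
        swapsPerm l (wordPerm s w.1 p) = wordPerm s w.2 (swapsPerm l p) :=
    hcheck.forall_mem_list.comp (primrec_pointsBelow.comp (hL.comp .snd)) .id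
  exact Primrec.list_head?.comp (hall.listFilter.comp
    (primrec_swapLists.comp (primrec_pointsBelow.comp hM)) .id)

theorem mem_FSym_and_semiconjBy_of_findConjugator_eq_some {σ τ : Perm ι} {t u : ι → ℤ}
    (ha : EventuallyPermutesRays (wordPerm s a) σ t N)
    (hb : EventuallyPermutesRays (wordPerm s b) τ u N) (hNM : N ≤ M)
    (hL : M + N < L) {l : List ((ι × ℕ) × (ι × ℕ))} (hl : findConjugator s M L a b = some l) :
    swapsPerm l ∈ FSym (ι × ℕ) ∧ SemiconjBy (swapsPerm l) (wordPerm s a) (wordPerm s b) := by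
  have hmem := List.mem_of_head? hl
  rw [List.mem_filter, decide_eq_true_iff] at hmem
  obtain ⟨hl, hcheck⟩ := hmem
  refine ⟨swapsPerm_mem_FSym hl, ha.semiconjBy_of_forall_lt hb hNM hL
    (fun p hp => ?_) fun p hp => ?_⟩
  · exact swapsPerm_apply_of_notMem hl (mem_pointsBelow.not.2 hp.not_gt)
  · exact hcheck p (mem_pointsBelow.2 hp)

theorem isSome_findConjugator_of_semiconjBy {x : Perm (ι × ℕ)} (hx : ∀ p, M ≤ p.2 → x p = p)
    (hxab : SemiconjBy x (wordPerm s a) (wordPerm s b)) : (findConjugator s M L a b).isSome := by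
  obtain ⟨l, hl, rfl⟩ := exists_mem_swapLists (P := pointsBelow ι M) fun p hp =>
    hx p (not_lt.1 (mem_pointsBelow.not.1 hp))
  rw [findConjugator, List.isSome_head?]
  refine List.ne_nil_of_mem (List.mem_filter.2 ⟨hl, decide_eq_true fun p _ => ?_⟩)
  exact semiconjBy_iff_forall_apply.1 hxab p

theorem isSome_findConjugator_iff {σ τ : Perm ι} {t u : ι → ℤ}
    (ha : EventuallyPermutesRays (wordPerm s a) σ t N)
    (hb : EventuallyPermutesRays (wordPerm s b) τ u N)
    (hM : 2 * N * (Fintype.card (Perm ι) + 1) ≤ M) (hL : M + N < L) :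
    (findConjugator s M L a b).isSome ↔
      ∃ x ∈ FSym (ι × ℕ), SemiconjBy x (wordPerm s a) (wordPerm s b) := by
  refine ⟨fun h => ?_, fun ⟨x, hx, hxab⟩ => ?_⟩
  · obtain ⟨l, hl⟩ := Option.isSome_iff_exists.1 h
    exact ⟨_, mem_FSym_and_semiconjBy_of_findConjugator_eq_some ha hb (by nlinarith) hL hl⟩
  · obtain ⟨y, hy, hfar⟩ :=
      ha.exists_semiconjBy_fixing_far hb Fintype.card_pos pow_card_eq_one hx hxab
    exact isSome_findConjugator_of_semiconjBy (fun p hp => hfar p (hM.trans hp)) hy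

end Search

theorem conjugates_iff_semiconjBy {α : Type*} {x a b : Perm α} :
    Conjugates x a b ↔ SemiconjBy x a b :=
  mul_inv_eq_iff_eq_mul

end Houghton

open Houghton in
theorem mainTheorem7_general {ι : Type*} [Finite ι] [DecidableEq ι] [Primcodable ι] {k : ℕ}
    (s : Fin k → Equiv.Perm (ι × ℕ)) (hs : ∀ j, s j ∈ extendedHoughtonGroup ι) :
    ∃ f : Word k → Word k → Option (List ((ι × ℕ) × (ι × ℕ))),
      Primrec₂ f ∧
      ∀ a b : Word k,
        ((f a b).isSome ↔ ∃ x ∈ FSym (ι × ℕ), Conjugates x (wordPerm s a) (wordPerm s b)) ∧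
        ∀ l, f a b = some l →
          swapsPerm l ∈ FSym (ι × ℕ) ∧ Conjugates (swapsPerm l) (wordPerm s a) (wordPerm s b) := by
  simp only [conjugates_iff_semiconjBy]
  have := Fintype.ofFinite ι
  obtain ⟨C, hC⟩ := exists_forall_letterPerm_eventuallyPermutesRays hs
  let N (w : Word k × Word k) : ℕ := C * (w.1.length + w.2.length)
  let M (w : Word k × Word k) : ℕ := 2 * N w * (Fintype.card (Equiv.Perm ι) + 1)
  have hN : Primrec N := Primrec.nat_mul.comp (.const C)
    (Primrec.nat_add.comp (Primrec.list_length.comp .fst) (Primrec.list_length.comp .snd))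
  have hM : Primrec M := Primrec.nat_mul.comp (Primrec.nat_mul.comp (.const 2) hN) (.const _)
  refine ⟨fun a b => findConjugator s (M (a, b)) (M (a, b) + N (a, b) + 1) a b,
    primrec_findConjugator (fun c => (hC c).choose_spec.choose_spec.primrec) hM
      (Primrec.succ.comp (Primrec.nat_add.comp hM hN)), fun a b => ?_⟩
  obtain ⟨σ, t, ha⟩ := exists_wordPerm_eventuallyPermutesRays hC a
  obtain ⟨τ, u, hb⟩ := exists_wordPerm_eventuallyPermutesRays hC b
  replace ha := ha.mono (M := N (a, b)) (Nat.mul_le_mul_left C (Nat.le_add_right _ _))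
  replace hb := hb.mono (M := N (a, b)) (Nat.mul_le_mul_left C (Nat.le_add_left _ _))
  have hNM : N (a, b) ≤ M (a, b) := by simp only [M]; nlinarith
  exact ⟨isSome_findConjugator_iff ha hb le_rfl (Nat.lt_succ_self _),
    fun l => mem_FSym_and_semiconjBy_of_findConjugator_eq_some ha hb hNM (Nat.lt_succ_self _)⟩

theorem mainTheorem7 (n k : ℕ) (s : Fin k → Equiv.Perm (Houghton.X n))
    (hs : ∀ j, s j ∈ Houghton.HS n) :
    ∃ f : Houghton.Word k → Houghton.Word k → Option (List (Houghton.X n × Houghton.X n)),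
      Computable₂ f ∧
      ∀ a b : Houghton.Word k,
        ((f a b).isSome ↔ ∃ x ∈ Houghton.FSym (Houghton.X n),
          Houghton.Conjugates x (Houghton.wordPerm s a) (Houghton.wordPerm s b)) ∧
        ∀ l, f a b = some l →
          Houghton.swapsPerm l ∈ Houghton.FSym (Houghton.X n) ∧
          Houghton.Conjugates (Houghton.swapsPerm l)
            (Houghton.wordPerm s a) (Houghton.wordPerm s b) := by
  obtain ⟨f, hf, h⟩ := mainTheorem7_general s fun j => Houghton.HS_le_extendedHoughtonGroup (hs j)
  exact ⟨f, hf.to_comp, h⟩
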